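/- **Model.** In the Congested Clique with bandwidth $B$, $n$ nodes, each knowing all identifiers, communicate in synchronous rounds. In every round each node sends $B$ bits (possibly different for different recipients) to every other node. The nodes are deterministic: the messages of a node are functions of its identifier, its own input and what it has received so far. In the $\mathsf{AllToAllComm}$ problem each node $u$ is given $n$ messages $\{m_{u,v}\}_{v\in V}$ of $B$ bits each, and every node $v$ has to output all the messages $\{m_{u,v}\}_{u\in V}$ addressed to it. An *adaptive $\alpha$-Byzantine-degree ($\alpha$-ABD) adversary* chooses in each round $i$ a set $F_i$ of edges of the complete graph on the nodes such that every node is incident to at most $\alpha n$ edges of $F_i$, and replaces the messages sent over the edges of $F_i$ (in both directions) by arbitrary $B$-bit messages, or suppresses them. The choice of $F_i$ and of the replaced messages may depend on the current local states of all nodes, on all messages sent in earlier rounds and on all messages that the nodes intend to send in round $i$. The nodes are not told $F_i$. **Theorem.** There is a universal constant $C>0$ such that for every $0\le\alpha\le \frac{1}{16\cdot 10^4}$ and every $n\ge 1$ there is a deterministic protocol for the $n$-node Congested Clique with bandwidth $B=1$ that runs for at most $C\log n$ rounds and solves $\mathsf{AllToAllComm}$ (with one-bit messages $m_{u,v}$)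 in the presence of every $\alpha$-ABD adversary: for all inputs and all behaviours of the adversary, every node $v$ outputs $m_{u,v}$ correctly for all nodes $u$. -/

import Mathlib

namespace CongestedClique

/-- A `B`-bit message. -/
abbrev Msg (B : ℕ) : Type := Fin B → Bool

/-- An instance of `AllToAllComm` on the node set `Fin n`: `m u v` is the `B`-bit message that node
`u` holds for node `v`. -/
abbrev Instance (n B : ℕ) : Type := Fin n → Fin n → Msg B

/-- A deterministic protocol for the `n`-node Congested Clique with bandwidth `B`, for a problem in
which every node starts with `n` messages of `B` bits and has to output `n` messages of `B` bits.
The nodes are numbered by `Fin n`, and every node knows `n` and the identifiers of all nodes.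

The protocol runs for a fixed number `rounds` of synchronous rounds, numbered `0, 1, …`. In every
round each node sends `B` bits to each node, as a function of its local state, and then updates its
local state as a function of what was delivered to it. -/
structure Protocol (n B : ℕ) where
  /-- The number of rounds. -/
  rounds : ℕ
  /-- The type of local states of a node. -/
  State : Type
  /-- The initial local state of node `u`, which sees only its own input messages. -/
  init : (u : Fin n) → (own : Fin n → Msg B) → State
  /-- `send t u s v` is the message that node `u`, in local state `s`, sends to `v` in round `t`. -/
  send : (t : ℕ) → (u : Fin n) → State → (v : Fin n) → Msg B
  /-- `update t v s r` is the new local state of node `v` at the end of round `t`, if its state was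
  `s` and `r u` was delivered to it on the link from `u` (`none`: nothing was delivered). -/
  update : (t : ℕ) → (v : Fin n) → State → (r : Fin n → Option (Msg B)) → State
  /-- `output v s u` is what node `v`, in final local state `s`, outputs for the message from `u`. -/
  output : (v : Fin n) → State → (u : Fin n) → Msg B

variable {n B : ℕ}

/-- A complete record of one round: the local states at its beginning, the messages that the nodes
intended to send (`sent u v` from `u` to `v`), and what was delivered (`delivered u v` from `u` to
`v`). -/
structure RoundRecord (P : Protocol n B) where
  state : Fin n → P.State
  sent : Fin n → Fin n → Msg B
  delivered : Fin n → Fin n → Option (Msg B)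

/-- An adaptive (rushing, mobile) `α`-Byzantine-degree adversary against the protocol `P`. In each
round it chooses a set of undirected edges of the clique, given as a simple graph, in which every
node has degree at most `α n`, and the content to be delivered on these edges, in both directions
(a message of `B` bits, or nothing). Both choices are arbitrary functions of the
records of all earlier rounds, the current local states of all nodes, and all messages that the
nodes intend to send in the current round. -/
structure Adversary (P : Protocol n B) (α : ℝ) where
  edges : (past : List (RoundRecord P)) → (state : Fin n → P.State) →
    (sent : Fin n → Fin n → Msg B) → SimpleGraph (Fin n)
  forge : (past : List (RoundRecord P)) → (state : Fin n → P.State) →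
    (sent : Fin n → Fin n → Msg B) → Fin n → Fin n → Option (Msg B)
  degree_le : ∀ past state sent v,
    (((edges past state sent).neighborSet v).ncard : ℝ) ≤ α * n

open Classical in
/-- The records of the first `t` rounds and the local states after them, in the execution of `P`
on the input `m` against the adversary `A`. -/
noncomputable def Protocol.run (P : Protocol n B) {α : ℝ} (A : Adversary P α) (m : Instance n B) :
    ℕ → List (RoundRecord P) × (Fin n → P.State)
  | 0 => ([], fun u => P.init u (m u))
  | t + 1 =>
    let past := (P.run A m t).1
    let state := (P.run A m t).2
    let sent : Fin n → Fin n → Msg B := fun u v => P.send t u (state u) v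
    let delivered : Fin n → Fin n → Option (Msg B) := fun u v =>
      if (A.edges past state sent).Adj u v then A.forge past state sent u v else some (sent u v)
    (past ++ [⟨state, sent, delivered⟩],
      fun v => P.update t v (state v) (fun u => delivered u v))

/-- `P` solves `AllToAllComm` in the presence of an adaptive `α`-Byzantine-degree adversary: whatever
the adversary does and whatever the input `m` is, after the last round every node `v` outputs
`m u v` for every node `u`. -/
def Protocol.SolvesAllToAllComm (P : Protocol n B) (α : ℝ) : Prop :=
  ∀ (A : Adversary P α) (m : Instance n B) (u v : Fin n),
    P.output v ((P.run A m P.rounds).2 v) u = m u v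

end CongestedClique

/-!
The protocol is the cyclic-shift ("Bruck") scheme for all-to-all communication, made robust by an
error-correcting code. The message from `u` to `v` is filed under its offset `d = v - u` (in the
cyclic group `Fin n`), so that every node holds exactly one bit for each offset. In stage `k` every
node `w` transfers its whole vector of `n` bits to `w + 2 ^ k`, and the receiver replaces its own
bits by the received ones at precisely the offsets whose `k`-th binary digit is `1`. After
`⌈log₂ n⌉` stages the bit with offset `d` has moved by `d`, hence is at its destination.

In a stage all nodes must transfer `n` bits to one other node each, along a cyclic shift. The vector
is encoded by a binary code of length `2 n`, which is sent in two halves of `n` bits. The `j`-th bit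
of a half goes to node `j`, and node `j` forwards it to the receiver; since the shift is a
permutation, every link carries one bit per round. A bit is lost only if the adversary holds the
link from the sender to `j` in the first of these rounds or the link from `j` to the receiver in
the second one, so that at most `4 α n` of the `2 n` bits are wrong, however the adversary adapts.
A code with `2 ^ n` words and minimum distance above `8 α n` exists by the Gilbert–Varshamov
argument (`exists_separated_finset`, `exists_code`), so the receiver decodes correctly
(`held_stage`).
-/

namespace CongestedClique

/-! ### Binary codes -/

/-- A Chernoff-type bound for Hamming balls: give `y` the weight `8` to the number of
coordinates where it agrees with `c`; all weights add up to `(8 + 1) ^ card ι`. -/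
theorem card_hammingBall_mul_le {ι : Type*} [Fintype ι] [DecidableEq ι] (c : ι → Bool) (r : ℕ) :
    (Finset.univ.filter fun y : ι → Bool => hammingDist c y ≤ r).card *
      8 ^ (Fintype.card ι - r) ≤ 9 ^ Fintype.card ι := by
  have total : ∑ y : ι → Bool, ∏ i, (if c i ≠ y i then 1 else 8) = 9 ^ Fintype.card ι := by
    have h := Finset.prod_univ_sum (fun _ : ι => (Finset.univ : Finset Bool))
      (fun i b => if c i ≠ b then (1 : ℕ) else 8)
    rw [Fintype.piFinset_univ] at h
    rw [← h]
    have : ∀ i, ∑ b : Bool, (if c i ≠ b then (1 : ℕ) else 8) = 9 := by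
      intro i
      cases c i <;> simp
    simp only [this, Finset.prod_const, Finset.card_univ]
  have weight : ∀ y : ι → Bool,
      ∏ i, (if c i ≠ y i then 1 else 8) = 8 ^ (Fintype.card ι - hammingDist c y) := by
    intro y
    rw [Finset.prod_ite, Finset.prod_const_one, Finset.prod_const, one_mul]
    congr 1
    have := Finset.card_filter_add_card_filter_not (s := (Finset.univ : Finset ι))
      (fun i => c i ≠ y i)
    rw [Finset.card_univ] at this
    unfold hammingDist
    omega
  rw [← total, ← smul_eq_mul, ← Finset.sum_const]
  refine (Finset.sum_le_sum fun y hy => ?_).trans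
    (Finset.sum_le_sum_of_subset (Finset.filter_subset _ _))
  rw [weight]
  have := (Finset.mem_filter.1 hy).2
  exact Nat.pow_le_pow_right (by norm_num) (by omega)

/-- The Gilbert–Varshamov argument: as long as the Hamming balls of radius `r` around the words
chosen so far do not cover the cube, another word can be added. -/
theorem exists_separated_finset {ι : Type*} [Fintype ι] [DecidableEq ι] {r V : ℕ}
    (hV : ∀ c : ι → Bool, (Finset.univ.filter fun y : ι → Bool => hammingDist c y ≤ r).card ≤ V)
    (M : ℕ) (hM : M * V ≤ 2 ^ Fintype.card ι) :
    ∃ S : Finset (ι → Bool), S.card = M ∧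
      ∀ x ∈ S, ∀ y ∈ S, x ≠ y → r < hammingDist x y := by
  induction M with
  | zero => exact ⟨∅, by simp⟩
  | succ M ih =>
    obtain ⟨S, hS, hsep⟩ := ih (le_trans (by gcongr; omega) hM)
    have hpos : 0 < V := by
      refine lt_of_lt_of_le (Finset.card_pos.2 ⟨fun _ => false, ?_⟩) (hV fun _ => false)
      simp
    obtain ⟨y, hy⟩ : ∃ y, y ∉ S.biUnion fun c =>
        Finset.univ.filter fun y : ι → Bool => hammingDist c y ≤ r := by
      by_contra! hall
      have hcard := Finset.card_biUnion_le_card_mul S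
        (fun c => Finset.univ.filter fun y : ι → Bool => hammingDist c y ≤ r) V fun c _ => hV c
      rw [Finset.eq_univ_iff_forall.2 hall, Finset.card_univ, hS] at hcard
      simp only [Fintype.card_fun, Fintype.card_bool] at hcard
      linarith
    have hfar : ∀ c ∈ S, r < hammingDist c y := by
      intro c hc
      by_contra hle
      exact hy (Finset.mem_biUnion.2 ⟨c, hc, by simpa using hle⟩)
    have hyS : y ∉ S := fun h => by simpa using hfar y h
    refine ⟨insert y S, by rw [Finset.card_insert_of_notMem hyS, hS], ?_⟩
    intro a ha b hb hab
    rcases Finset.mem_insert.1 ha with rfl | haS <;> rcases Finset.mem_insert.1 hb with rfl | hbS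
    · exact absurd rfl hab
    · exact hammingDist_comm b a ▸ hfar b hbS
    · exact hfar a haS
    · exact hsep a haS b hbS hab

/-- There is a binary code of rate `1 / 2` that corrects a fraction of errors of `1 / 80000`: `E`
encodes `n` bits into two blocks of `n` bits, and `D` decodes. -/
theorem exists_code (n : ℕ) :
    ∃ (E : (Fin n → Bool) → Fin n ⊕ Fin n → Bool) (D : (Fin n ⊕ Fin n → Bool) → Fin n → Bool),
      ∀ x y, 40000 * hammingDist (E x) y ≤ n → D y = x := by
  set r := n / 20000 with hr
  have hball : ∀ c : Fin n ⊕ Fin n → Bool,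
      (Finset.univ.filter fun y => hammingDist c y ≤ r).card ≤ 2 ^ n := by
    intro c
    set V := (Finset.univ.filter fun y => hammingDist c y ≤ r).card
    have h := card_hammingBall_mul_le c r
    rw [Fintype.card_sum, Fintype.card_fin] at h
    have h1 : 8 ^ (n + n - r) * 8 ^ r = 64 ^ n := by
      rw [← pow_add, Nat.sub_add_cancel (by omega), ← two_mul, pow_mul]
      norm_num
    have h2 : 8 ^ r * 2 ^ n ≤ 3 ^ n := by
      obtain ⟨q, hq⟩ : ∃ q, n = 6 * r + q := ⟨n - 6 * r, by omega⟩
      calc 8 ^ r * 2 ^ n = 512 ^ r * 2 ^ q := by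
            rw [hq, pow_add, pow_mul, ← mul_assoc, ← mul_pow]; norm_num
        _ ≤ 729 ^ r * 3 ^ q := by gcongr <;> norm_num
        _ = 3 ^ n := by rw [hq, pow_add, pow_mul]; norm_num
    have h3 : V * 128 ^ n ≤ 2 ^ n * 128 ^ n := by
      calc V * 128 ^ n = V * (64 ^ n * 2 ^ n) := by rw [← mul_pow]; norm_num
        _ = (V * 8 ^ (n + n - r)) * (8 ^ r * 2 ^ n) := by rw [← h1]; ring
        _ ≤ 9 ^ (n + n) * 3 ^ n := Nat.mul_le_mul h h2
        _ = 243 ^ n := by rw [← two_mul, pow_mul, ← mul_pow]; norm_num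
        _ ≤ 256 ^ n := by gcongr; norm_num
        _ = 2 ^ n * 128 ^ n := by rw [← mul_pow]; norm_num
    exact Nat.le_of_mul_le_mul_right h3 (by positivity)
  obtain ⟨S, hS, hsep⟩ := exists_separated_finset hball (2 ^ n)
    (by rw [Fintype.card_sum, Fintype.card_fin, pow_add])
  have e : (Fin n → Bool) ≃ S := Fintype.equivOfCardEq (by simp [hS])
  refine ⟨fun x => e x, fun y => Classical.epsilon fun x => 40000 * hammingDist (e x).1 y ≤ n,
    fun x y hxy => ?_⟩
  have hD := Classical.epsilon_spec (p := fun x => 40000 * hammingDist (e x).1 y ≤ n) ⟨x, hxy⟩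
  by_contra hne
  have hlt := hsep _ (e _).2 _ (e _).2 fun h => hne (e.injective (Subtype.ext h))
  have htri := hammingDist_triangle_right (e (Classical.epsilon fun x =>
    40000 * hammingDist (e x).1 y ≤ n)).1 (e x).1 y
  dsimp only at hxy hlt
  omega

/-! ### One round against the adversary -/

/-- In every round, each node has at most `α n` bad outgoing and at most `α n` bad incoming links,
where a link is bad if what it delivers is not what was sent. -/
theorem Protocol.run_succ {n B : ℕ} (P : Protocol n B) {α : ℝ} (A : Adversary P α)
    (m : Instance n B) (t : ℕ) :
    ∃ del : Fin n → Fin n → Option (Msg B),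
      (∀ v, (P.run A m (t + 1)).2 v =
        P.update t v ((P.run A m t).2 v) fun u => del u v) ∧
      (∀ u, ((Finset.univ.filter fun v =>
        del u v ≠ some (P.send t u ((P.run A m t).2 u) v)).card : ℝ) ≤ α * n) ∧
      (∀ v, ((Finset.univ.filter fun u =>
        del u v ≠ some (P.send t u ((P.run A m t).2 u) v)).card : ℝ) ≤ α * n) := by
  classical
  set past := (P.run A m t).1
  set state := (P.run A m t).2
  set sent : Fin n → Fin n → Msg B := fun u v => P.send t u (state u) v
  set G := A.edges past state sent
  have hdeg : ∀ (w : Fin n) (p : Fin n → Prop) [DecidablePred p], (∀ z, p z → G.Adj w z) →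
      ((Finset.univ.filter p).card : ℝ) ≤ α * n := by
    intro w p _ hp
    refine le_trans ?_ (A.degree_le past state sent w)
    rw [← Set.ncard_coe_finset]
    exact_mod_cast Set.ncard_le_ncard (t := G.neighborSet w)
      (fun z hz => hp z (Finset.mem_filter.1 hz).2) (Set.toFinite _)
  refine ⟨fun u v => if G.Adj u v then A.forge past state sent u v else some (sent u v),
    fun v => rfl, fun u => hdeg u _ fun v hv => ?_, fun v => hdeg v _ fun u hu => ?_⟩
  · by_contra hadj
    exact hv (if_neg hadj)
  · by_contra hadj
    exact hu (if_neg fun h => hadj h.symm)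

/-! ### The protocol -/

/-- The local state of a node. -/
structure ShiftState (n : ℕ) where
  /-- The bit currently held for each offset `d`. -/
  held : Fin n → Bool
  /-- The bits received for forwarding, indexed by the node they come from. -/
  relay : Fin n → Bool
  /-- The first half of the codeword that is being received. -/
  half : Fin n → Bool

/-- The bit delivered on each link; a suppressed message is read as `false`. -/
def readBits {n : ℕ} (r : Fin n → Option (Msg 1)) (u : Fin n) : Bool :=
  (r u).elim false fun b => b 0

/-- The bit that a node in state `s` sends to `v` in round `t`: a bit of its codeword, or the bit
that it relays to `v`, which comes from the node `v - 2 ^ (t / 4)`. -/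
def shiftSend {n : ℕ} [NeZero n] (E : (Fin n → Bool) → Fin n ⊕ Fin n → Bool) (t : ℕ)
    (s : ShiftState n) (v : Fin n) : Bool :=
  if t % 4 = 0 then E s.held (Sum.inl v)
  else if t % 4 = 2 then E s.held (Sum.inr v)
  else s.relay (v - Fin.ofNat n (2 ^ (t / 4)))

/-- The state of a node after it has received the bits `b` in round `t`. -/
def shiftUpdate {n : ℕ} (D : (Fin n ⊕ Fin n → Bool) → Fin n → Bool) (t : ℕ)
    (s : ShiftState n) (b : Fin n → Bool) : ShiftState n :=
  if t % 4 = 1 then { s with half := b }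
  else if t % 4 = 3 then
    { s with
      held := fun d => if (d : ℕ).testBit (t / 4) then D (Sum.elim s.half b) d else s.held d }
  else { s with relay := b }

/-- The shift protocol with encoder `E` and decoder `D`. Stage `k` consists of the rounds `4 * k`,
…, `4 * k + 3`: the first two transfer the first half of the codewords via the relays, the last two
the second half. -/
def shiftProtocol (n : ℕ) [NeZero n] (E : (Fin n → Bool) → Fin n ⊕ Fin n → Bool)
    (D : (Fin n ⊕ Fin n → Bool) → Fin n → Bool) : Protocol n 1 where
  rounds := 4 * Nat.clog 2 n
  State := ShiftState n
  init u own := ⟨fun d => own (u + d) 0, fun _ => false, fun _ => false⟩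
  send t _ s v _ := shiftSend E t s v
  update t _ s r := shiftUpdate D t s (readBits r)
  output v s u _ := s.held (v - u)

/-! ### Correctness of the protocol -/

/-- A codeword bit that passes two links arrives intact unless one of them is bad. -/
theorem card_relay_errors_le {n : ℕ} {a : ℝ} {x : Fin n → Bool} {f g : Fin n → Option (Msg 1)}
    (hf : ((Finset.univ.filter fun j => f j ≠ some fun _ => x j).card : ℝ) ≤ a)
    (hg : ((Finset.univ.filter fun j => g j ≠ some fun _ => readBits f j).card : ℝ) ≤ a) :
    (hammingDist x (readBits g) : ℝ) ≤ 2 * a := by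
  have hsub : (Finset.univ.filter fun j => x j ≠ readBits g j) ⊆
      (Finset.univ.filter fun j => f j ≠ some fun _ => x j) ∪
        Finset.univ.filter fun j => g j ≠ some fun _ => readBits f j := by
    intro j hj
    simp only [Finset.mem_union, Finset.mem_filter, Finset.mem_univ, true_and] at hj ⊢
    by_contra! hcon
    exact hj (by simp [readBits, hcon.1, hcon.2])
  have hcard : hammingDist x (readBits g) ≤ _ :=
    (Finset.card_le_card hsub).trans (Finset.card_union_le _ _)
  have := (Nat.cast_le (α := ℝ)).2 hcard
  push_cast at this
  linarith

theorem hammingDist_sumElim {n : ℕ} (c : Fin n ⊕ Fin n → Bool) (y z : Fin n → Bool) :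
    hammingDist c (Sum.elim y z) =
      hammingDist (fun j => c (Sum.inl j)) y + hammingDist (fun j => c (Sum.inr j)) z := by
  simp only [hammingDist, Finset.card_filter, Fintype.sum_sum_type, Sum.elim_inl, Sum.elim_inr]
  congr!

section

variable {n : ℕ} [NeZero n] {E : (Fin n → Bool) → Fin n ⊕ Fin n → Bool}
  {D : (Fin n ⊕ Fin n → Bool) → Fin n → Bool} {α : ℝ}

/-- The state of node `v` after `t` rounds. -/
noncomputable def shiftRun (A : Adversary (shiftProtocol n E D) α) (m : Instance n 1) (t : ℕ)
    (v : Fin n) : ShiftState n :=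
  ((shiftProtocol n E D).run A m t).2 v

theorem shiftRun_succ (A : Adversary (shiftProtocol n E D) α) (m : Instance n 1) (t : ℕ) :
    ∃ del : Fin n → Fin n → Option (Msg 1),
      (∀ v, shiftRun A m (t + 1) v =
        shiftUpdate D t (shiftRun A m t v) (readBits fun u => del u v)) ∧
      (∀ u, ((Finset.univ.filter fun v =>
        del u v ≠ some fun _ => shiftSend E t (shiftRun A m t u) v).card : ℝ) ≤ α * n) ∧
      (∀ v, ((Finset.univ.filter fun u =>
        del u v ≠ some fun _ => shiftSend E t (shiftRun A m t u) v).card : ℝ) ≤ α * n) :=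
  (shiftProtocol n E D).run_succ A m t

/-- The effect of one stage: whatever the adversary does, the bits whose offset has `k`-th binary
digit `1` move by `2 ^ k`, and all others stay. -/
theorem held_stage (hED : ∀ x y, 40000 * hammingDist (E x) y ≤ n → D y = x)
    (hα : α ≤ 1 / (16 * 10 ^ 4)) (A : Adversary (shiftProtocol n E D) α) (m : Instance n 1)
    (k : ℕ) (v d : Fin n) :
    (shiftRun A m (4 * (k + 1)) v).held d =
      if (d : ℕ).testBit k then (shiftRun A m (4 * k) (v - Fin.ofNat n (2 ^ k))).held d
      else (shiftRun A m (4 * k) v).held d := by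
  have m1 : (4 * k + 1) % 4 = 1 := by omega
  have m2 : (4 * k + 2) % 4 = 2 := by omega
  have m3 : (4 * k + 3) % 4 = 3 := by omega
  have d1 : (4 * k + 1) / 4 = k := by omega
  have d3 : (4 * k + 3) / 4 = k := by omega
  -- `h0`, …, `h3` describe the states. In even rounds the bad links out of the sender matter, in odd
  -- rounds those into the receiver.
  obtain ⟨del0, h0, out0, -⟩ := shiftRun_succ A m (4 * k)
  obtain ⟨del1, h1, -, in1⟩ := shiftRun_succ A m (4 * k + 1)
  obtain ⟨del2, h2, out2, -⟩ := shiftRun_succ A m (4 * k + 2)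
  obtain ⟨del3, h3, -, in3⟩ := shiftRun_succ A m (4 * k + 3)
  replace out0 := out0 (v - Fin.ofNat n (2 ^ k))
  replace out2 := out2 (v - Fin.ofNat n (2 ^ k))
  replace in1 := in1 v
  replace in3 := in3 v
  simp only [shiftUpdate, shiftSend, Nat.mul_mod_right, m1, m2, m3, d1, d3, reduceIte,
    Nat.reduceEqDiff, OfNat.ofNat_ne_zero, OfNat.zero_ne_ofNat, OfNat.ofNat_ne_one,
    OfNat.one_ne_ofNat, one_ne_zero, zero_ne_one] at h0 h1 h2 h3 out0 in1 out2 in3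
  simp only [h0, h1, h2] at out2 in1 in3
  have hfirst := card_relay_errors_le out0 in1
  have hsecond := card_relay_errors_le out2 in3
  rw [show 4 * (k + 1) = 4 * k + 3 + 1 by ring, h3]
  simp only [h0, h1, h2]
  split_ifs with hd
  · rw [hED (shiftRun A m (4 * k) (v - Fin.ofNat n (2 ^ k))).held]
    rw [hammingDist_sumElim]
    -- The four bounds `α n` add up to `n / 40000`, which is what the code corrects.
    have hαn : α * n ≤ 1 / (16 * 10 ^ 4) * n := by gcongr
    have hsum := add_le_add hfirst hsecond
    rw [← Nat.cast_le (α := ℝ)]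
    push_cast
    linarith
  · rfl

/-- After `k` stages the bit with offset `d` has moved by `d % 2 ^ k`. -/
theorem held_after_stages (hED : ∀ x y, 40000 * hammingDist (E x) y ≤ n → D y = x)
    (hα : α ≤ 1 / (16 * 10 ^ 4)) (A : Adversary (shiftProtocol n E D) α) (m : Instance n 1)
    (k : ℕ) (v d : Fin n) :
    (shiftRun A m (4 * k) v).held d =
      m (v - Fin.ofNat n (d % 2 ^ k)) (v - Fin.ofNat n (d % 2 ^ k) + d) 0 := by
  induction k generalizing v with
  | zero =>
    have : Fin.ofNat n (d % 2 ^ 0) = 0 := by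
      rw [pow_zero, Nat.mod_one]
      rfl
    rw [this, sub_zero]
    rfl
  | succ k ih =>
    rw [held_stage hED hα]
    split_ifs with hd
    · have : Fin.ofNat n (d % 2 ^ (k + 1)) =
          Fin.ofNat n (2 ^ k) + Fin.ofNat n (d % 2 ^ k) := by
        rw [Nat.mod_pow_succ, ← Nat.toNat_testBit, hd]
        ext
        simp [Fin.val_add, add_comm]
      rw [ih, this, sub_sub]
    · rw [ih, Nat.mod_pow_succ, ← Nat.toNat_testBit, Bool.eq_false_of_not_eq_true hd]
      simp

theorem shiftProtocol_solves (hED : ∀ x y, 40000 * hammingDist (E x) y ≤ n → D y = x)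
    (hα : α ≤ 1 / (16 * 10 ^ 4)) : (shiftProtocol n E D).SolvesAllToAllComm α := by
  intro A m u v
  funext i
  have hlt : ((v - u : Fin n) : ℕ) < 2 ^ Nat.clog 2 n :=
    (v - u).isLt.trans_le (Nat.le_pow_clog (by norm_num) n)
  have h := held_after_stages hED hα A m (Nat.clog 2 n) v (v - u)
  rw [Nat.mod_eq_of_lt hlt, Fin.ofNat_val_eq_self, sub_sub_cancel, add_sub_cancel] at h
  rw [Subsingleton.elim i 0]
  exact h

end

/-! ### The number of rounds -/

theorem clog_two_le_mul_log {n : ℕ} (hn : 1 ≤ n) : 4 * (Nat.clog 2 n : ℝ) ≤ 12 * Real.log n := by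
  rcases hn.eq_or_lt with rfl | hn
  · simp
  have hlt : 2 ^ (Nat.clog 2 n - 1) < n := Nat.pow_pred_clog_lt_self (by norm_num) hn
  have h1 : ((Nat.clog 2 n - 1 : ℕ) : ℝ) * Real.log 2 ≤ Real.log n := by
    rw [← Real.log_pow]
    exact Real.log_le_log (by positivity) (by exact_mod_cast hlt.le)
  have h2 : Real.log 2 ≤ Real.log n := Real.log_le_log (by norm_num) (by exact_mod_cast hn)
  rw [Nat.cast_sub (Nat.clog_pos (by norm_num) hn)] at h1
  push_cast at h1
  have h3 : (0 : ℝ) ≤ Nat.clog 2 n := by positivity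
  nlinarith [Real.log_two_gt_d9]

end CongestedClique

theorem mainTheorem4 :
    ∃ C : ℝ, 0 < C ∧ ∀ α : ℝ, 0 ≤ α → α ≤ 1 / (16 * 10 ^ 4) → ∀ n : ℕ, 1 ≤ n →
      ∃ P : CongestedClique.Protocol n 1,
        (P.rounds : ℝ) ≤ C * Real.log n ∧ P.SolvesAllToAllComm α := by
  refine ⟨12, by norm_num, fun α _ hα n hn => ?_⟩
  have : NeZero n := ⟨by omega⟩
  obtain ⟨E, D, hED⟩ := CongestedClique.exists_code n
  refine ⟨CongestedClique.shiftProtocol n E D, ?_, CongestedClique.shiftProtocol_solves hED hα⟩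
  have := CongestedClique.clog_two_le_mul_log hn
  simpa [CongestedClique.shiftProtocol] using this
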